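/- Conventions. A vertex algebra is a $\mathbb{C}$-vector space $V$ with a linear map $a\mapsto Y(a,z)=\sum_{n\in\mathbb{Z}}a(n)z^{-n-1}\in \mathrm{End}(V)[[z^{\pm1}]]$ and a non-zero vector $\mathbf 1$ such that for all $a,b\in V$: $a(n)b=0$ for $n\gg 0$; $a(n)\mathbf 1=0$ for $n\ge 0$ and $a(-1)\mathbf 1=a$; and the Borcherds identity holds. Put $Ta=a(-2)\mathbf 1$. A conformal vertex algebra $(V,\omega)$ is a vertex algebra with $\omega\in V$ such that the operators $L(n)=\omega(n+1)$ satisfy the Virasoro relations for some central charge $c\in\mathbb{C}$, $L(-1)=T$, and $L(0)$ is diagonalizable with integer eigenvalues; $V_\mu$ is the $\mu$-eigenspace of $L(0)$. A Heisenberg subspace of $V$ is a finite-dimensional subspace $H\subset V$ such that, for $h,h'\in H$, $h(n)h'=0$ if $n\ge 2$, $h(1)h'=(h,h')\mathbf 1$ with $(h,h')\in\mathbb{C}$, and the bilinear form $(-,-)$ on $H$ is non-degenerate. (The relation $h(0)h'=0$ follows from (A5) below.) Let $\omega_H=\frac12\sum_i h_i(-1)h^i$ for a basis $(h_i)$ of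 $H$ and its dual basis $(h^i)$. For $\alpha\in H$ let $\Omega_{V,H}^\alpha$ be the space of all $v\in V$ with $Tv=\omega_H(0)v$, $h(n)v=0$ for $n\ge 1$ and $h(0)v=(h,\alpha)v$, for all $h\in H$, and put $\Omega_{V,H}=\bigoplus_{\alpha\in H}\Omega^\alpha_{V,H}$, with product $vw=v(-(\alpha,\beta)-1)w$ if $Y(v,z)w\neq 0$ (in which case $(\alpha,\beta)\in\mathbb{Z}$) and $vw=0$ otherwise, for $v\in\Omega^\alpha_{V,H}$, $w\in\Omega^\beta_{V,H}$. The pair $(V,H)$ is good if $\Omega^0_{V,H}=\mathbb{C}\mathbf 1$ and $vw\ne 0$ for all non-zero $v\in\Omega_{V,H}^\alpha$, $w\in\Omega_{V,H}^\beta$, $\alpha,\beta\in H$. In that case its maximal lattice is $L_{V,H}=\{\alpha\in H : \Omega^\alpha_{V,H}\neq0 \text{ and } \Omega^{-\alpha}_{V,H}\ne 0\}$, and the lattice part of $\Omega_{V,H}$ is $(\Omega_{V,H})^{\mathrm{lat}}=\bigoplus_{\alpha\in L_{V,H}}\Omega^\alpha_{V,H}$. For $\mu\in\mathbb{C}$ and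 $\alpha\in H$ put $V_\mu^\alpha=\{v\in V_\mu : h(0)v=(h,\alpha)v \text{ for all } h\in H\}$ (zero unless $\mu\in\mathbb{Z}$), and $M_{V,H}=\{\alpha\in H : V_n^\alpha\ne0\text{ for some }n\in\mathbb{Z}\}$. The triple $(V,\omega,H)$ satisfies Assumption (A) if: (A1) $L(n)h=0$ and $L(0)h=h$ for all $n\ge1$, $h\in H$; (A2) $h(0)$ is diagonalizable on $V$ for every $h\in H$; (A3) $(\alpha,\beta)\in\mathbb{R}$ for all $\alpha,\beta\in M_{V,H}$; (A4) $V_n^\alpha=0$ whenever $\alpha\in M_{V,H}$, $n\in\mathbb{Z}$ and $\frac{(\alpha,\alpha)}2>n$; (A5) $V_0^0=\mathbb{C}\mathbf 1$ and $V_1^0=H$; (A6) every $V_n^\alpha$ is finite-dimensional; (A7) $V$ is isomorphic as a $V$-module to the restricted dual $V_H^\vee=\bigoplus_{n\in\mathbb{Z},\,\alpha\in M_{V,H}}(V_n^\alpha)^*$ with the action $(Y(a,z)f)(v)=f\big(Y(e^{zL(1)}(-z^{-2})^{L(0)}a,z^{-1})v\big)$. Theorem. Let $(V,\omega)$ be a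 conformal vertex algebra and $H\subset V$ a Heisenberg subspace such that $(V,\omega,H)$ satisfies Assumption (A). Set $L'_{V,H}=\{\alpha\in H : V^\alpha_{(\alpha,\alpha)/2}\neq 0\}$. Then $(V,H)$ is good, the sum of the subspaces $V^\alpha_{(\alpha,\alpha)/2}$, $\alpha\in L'_{V,H}$, is direct, and $$(\Omega_{V,H})^{\mathrm{lat}}=\bigoplus_{\alpha\in L'_{V,H}}V^\alpha_{(\alpha,\alpha)/2}.$$ In particular, $L'_{V,H}$ is equal to the maximal lattice $L_{V,H}$. -/

import Mathlib

noncomputable section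

/-- A vertex algebra over `ℂ`. The field `Y` is the linear map `a ↦ ∑ₙ a(n) z^(-n-1)` from `V` to
`End(V)[[z, z⁻¹]]`, given by its modes: `Y a n` is the operator `a(n)`. The sums in the Borcherds
identity are finite by truncation. -/
class VertexAlgebra (V : Type*) [AddCommGroup V] [Module ℂ V] where
  /-- the modes `a(n)` -/
  Y : V →ₗ[ℂ] ℤ → Module.End ℂ V
  /-- the vacuum vector -/
  vac : V
  vac_ne_zero : vac ≠ 0
  truncation : ∀ a b : V, ∃ N : ℤ, ∀ n : ℤ, N ≤ n → Y a n b = 0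
  creation_nonneg : ∀ (a : V) (n : ℤ), 0 ≤ n → Y a n vac = 0
  creation_neg_one : ∀ a : V, Y a (-1) vac = a
  borcherds : ∀ (a b c : V) (p q r : ℤ),
    ∑ᶠ i : ℕ, Ring.choose p i • Y (Y a (r + i) b) (p + q - i) c =
      ∑ᶠ i : ℕ, ((-1 : ℂ) ^ i) • (Ring.choose r i •
        (Y a (p + r - i) (Y b (q + i) c) - ((-1 : ℂ) ^ r) • Y b (q + r - i) (Y a (p + i) c)))

namespace VertexAlgebra

/-- A semisimple (that is, diagonalizable) operator: the space, possibly of infinite dimension,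
is the sum of the eigenspaces. -/
def Diagonalizable {V : Type*} [AddCommGroup V] [Module ℂ V] (f : Module.End ℂ V) : Prop :=
  ⨆ μ : ℂ, f.eigenspace μ = ⊤

variable {V : Type*} [AddCommGroup V] [Module ℂ V] [VertexAlgebra V]

/-- The translation operator `T a = a(-2)𝟏`. -/
def T : Module.End ℂ V where
  toFun a := Y a (-2) (vac : V)
  map_add' a b := by simp
  map_smul' c a := by simp

/-- The operators `L(n) = ω(n+1)`. -/
def L (ω : V) (n : ℤ) : Module.End ℂ V := Y ω (n + 1)

/-- `(V, ω)` is a conformal vertex algebra. -/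
structure IsConformal (ω : V) : Prop where
  virasoro : ∃ c : ℂ, ∀ m n : ℤ,
    L ω m * L ω n - L ω n * L ω m =
      ((m : ℂ) - n) • L ω (m + n) +
        (if m + n = 0 then (((m : ℂ) ^ 3 - m) / 12 * c) • (1 : Module.End ℂ V) else 0)
  translation : L ω (-1) = (T : Module.End ℂ V)
  semisimple : Diagonalizable (L ω 0)
  integral : ∀ μ : ℂ, (L ω 0).HasEigenvalue μ → ∃ n : ℤ, μ = n

/-- `V_μ`, the `μ`-eigenspace of `L(0)`. For `(V, ω)` conformal it vanishes unless `μ ∈ ℤ`. -/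
def weightSpace (ω : V) (μ : ℂ) : Submodule ℂ V := (L ω 0).eigenspace μ

/-- A conformal vertex algebra is the direct sum of the `V_n`, `n ∈ ℤ`. -/
theorem IsConformal.isInternal {ω : V} (hω : IsConformal ω) :
    DirectSum.IsInternal (fun n : ℤ => weightSpace ω (n : ℂ)) := by
  apply DirectSum.isInternal_submodule_of_iSupIndep_of_iSup_eq_top
  · exact (Module.End.eigenspaces_iSupIndep (L ω 0)).comp Int.cast_injective
  · rw [eq_top_iff, ← hω.semisimple]
    refine iSup_le fun μ => ?_
    by_cases h : (L ω 0).eigenspace μ = ⊥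
    · simp [h]
    · obtain ⟨n, rfl⟩ := hω.integral μ h
      exact le_iSup (fun n : ℤ => weightSpace ω (n : ℂ)) n

/-- The component in `V_k` of a vector. -/
def IsConformal.component {ω : V} (hω : IsConformal ω) (k : ℤ) (a : V) : V :=
  ((LinearEquiv.ofBijective (DirectSum.coeLinearMap fun n : ℤ => weightSpace ω (n : ℂ))
    hω.isInternal).symm a k : weightSpace ω (k : ℂ))

/-- The mode `a(n)` of the contragredient operators
`(Y^∨(a, z) f)(v) = f (Y(e^{zL(1)} (-z⁻²)^{L(0)} a, z⁻¹) v)`, as an operator on functionals on `V`: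
taking the coefficient of `z^(-n-1)`, for `a = ∑ₖ aₖ` with `aₖ ∈ V_k`,
`(a(n) f)(v) = ∑ₖ ∑ⱼ (-1)^k / j! · f ((L(1)^j aₖ)(2k - n - j - 2) v)`.
The sums are finite when `L(1)` is locally nilpotent. -/
def IsConformal.dualMode {ω : V} (hω : IsConformal ω) (a : V) (n : ℤ) (f : Module.Dual ℂ V) :
    Module.Dual ℂ V :=
  ∑ᶠ k : ℤ, ∑ᶠ j : ℕ, ((-1 : ℂ) ^ k * ((j.factorial : ℂ))⁻¹) •
    (f ∘ₗ Y ((L ω 1 ^ j) (hω.component k a)) (2 * k - n - j - 2))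

/-- For a subspace `H` with `h(1)h' ∈ ℂ𝟏`, the bilinear form given by `h(1)h' = (h,h')𝟏`. -/
def formOf (H : Submodule ℂ V) (h1 : ∀ h h' : H, Y (h : V) 1 (h' : V) ∈ ℂ ∙ (vac : V)) :
    LinearMap.BilinForm ℂ H :=
  let e := LinearEquiv.toSpanNonzeroSingleton ℂ V (vac : V) vac_ne_zero
  LinearMap.mk₂ ℂ (fun h h' => e.symm ⟨Y (h : V) 1 (h' : V), h1 h h'⟩)
    (fun x y z => by rw [← map_add]; congr 1; ext; simp)
    (fun c x y => by rw [← map_smul]; congr 1; ext; simp)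
    (fun x y z => by rw [← map_add]; congr 1; ext; simp)
    (fun c x y => by rw [← map_smul]; congr 1; ext; simp)

theorem formOf_spec (H : Submodule ℂ V)
    (h1 : ∀ h h' : H, Y (h : V) 1 (h' : V) ∈ ℂ ∙ (vac : V)) (h h' : H) :
    Y (h : V) 1 (h' : V) = formOf H h1 h h' • (vac : V) := by
  have := (LinearEquiv.toSpanNonzeroSingleton ℂ V (vac : V) vac_ne_zero).apply_symm_apply
    ⟨Y (h : V) 1 (h' : V), h1 h h'⟩
  exact (congrArg Subtype.val this).symm

variable (V) in
/-- A (finite-dimensional) Heisenberg subspace of a vertex algebra; with it, `V` is a VH pair. -/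
structure HeisenbergSubspace where
  H : Submodule ℂ V
  finiteDimensional : FiniteDimensional ℂ H
  mode_one : ∀ h h' : H, Y (h : V) 1 (h' : V) ∈ ℂ ∙ (vac : V)
  mode_ge_two : ∀ (h h' : H) (n : ℤ), 2 ≤ n → Y (h : V) n (h' : V) = 0
  nondegenerate : (formOf H mode_one).Nondegenerate

namespace HeisenbergSubspace

variable (P : HeisenbergSubspace V)

/-- The form `(-,-)` on `H`, with `h(1)h' = (h,h')𝟏`. -/
def form : LinearMap.BilinForm ℂ P.H := formOf P.H P.mode_one

/-- The Sugawara vector `ω_H = ½ ∑ᵢ hᵢ(-1)hⁱ`, for a basis `hᵢ` of `H` and its dual basis `hⁱ`. -/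
def sugawara : V :=
  letI := P.finiteDimensional
  let b := Module.finBasis ℂ P.H
  (1 / 2 : ℂ) • ∑ i, Y (b i : V) (-1) (LinearMap.BilinForm.dualBasis P.form P.nondegenerate b i : V)

/-- `Ω^α`: the vectors `v` with `T v = ω_H(0) v`, with `h(n) v = 0` for `n ≥ 1` and with
`h(0) v = (h,α) v`. -/
def Omega (α : P.H) : Submodule ℂ V where
  carrier := {v | T v = Y P.sugawara 0 v ∧
    (∀ (h : P.H) (n : ℤ), 1 ≤ n → Y (h : V) n v = 0) ∧
    ∀ h : P.H, Y (h : V) 0 v = P.form h α • v}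
  zero_mem' := by simp
  add_mem' := by
    rintro v w ⟨h1, h2, h3⟩ ⟨k1, k2, k3⟩
    refine ⟨by rw [map_add, map_add, h1, k1], fun h n hn => ?_, fun h => ?_⟩
    · rw [map_add, h2 h n hn, k2 h n hn, add_zero]
    · rw [map_add, h3, k3, smul_add]
  smul_mem' := by
    rintro c v ⟨h1, h2, h3⟩
    refine ⟨by rw [map_smul, map_smul, h1], fun h n hn => ?_, fun h => ?_⟩
    · rw [map_smul, h2 h n hn, smul_zero]
    · rw [map_smul, h3, smul_comm]

open Classical in
/-- The product of `v ∈ Ω^α` and `w ∈ Ω^β` in the algebra `Ω = ⨁ Ω^α`: it is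
`v(-(α,β)-1)w` if `Y(v,z)w ≠ 0` (which forces `(α,β) ∈ ℤ`), and `0` otherwise. -/
def omegaMul (α β : P.H) (v w : V) : V :=
  if h : ∃ m : ℤ, P.form α β = m then Y v (-h.choose - 1) w else 0

/-- `(V, H)` is a good VH pair: `Ω^0 = ℂ𝟏`, and the product of nonzero homogeneous elements
of `Ω` is nonzero. -/
def IsGood : Prop :=
  P.Omega 0 = ℂ ∙ (vac : V) ∧
  ∀ (α β : P.H), ∀ v ∈ P.Omega α, ∀ w ∈ P.Omega β, v ≠ 0 → w ≠ 0 → P.omegaMul α β v w ≠ 0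

/-- The maximal lattice `{α ∈ H | Ω^α ≠ 0 and Ω^{-α} ≠ 0}`. -/
def maximalLattice : Set P.H := {α | P.Omega α ≠ ⊥ ∧ P.Omega (-α) ≠ ⊥}

/-- The lattice part of `Ω`: the sum of the `Ω^α` over the maximal lattice. -/
def latticePart : Submodule ℂ V := ⨆ α : P.maximalLattice, P.Omega α

/-- `V_μ^α`: the vectors `v ∈ V_μ` with `h(0) v = (h,α) v` for all `h ∈ H`. -/
def bigraded (ω : V) (μ : ℂ) (α : P.H) : Submodule ℂ V :=
  weightSpace ω μ ⊓ ⨅ h : P.H, (Y (h : V) 0).eigenspace (P.form h α)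

/-- `M_{V,H}`: the `α ∈ H` with `V_n^α ≠ 0` for some integer `n`. -/
def weights (ω : V) : Set P.H := {α | ∃ n : ℤ, P.bigraded ω n α ≠ ⊥}

/-- The restricted dual `V_H^∨ = ⨁ (V_n^α)^*`, for `V = ⨁ V_n^α`: the functionals on `V` that vanish
on all but finitely many of the `V_n^α`. -/
def restrictedDual (ω : V) : Submodule ℂ (Module.Dual ℂ V) where
  carrier := {f | {x : ℤ × P.H | ∃ v ∈ P.bigraded ω x.1 x.2, f v ≠ 0}.Finite}
  zero_mem' := by simp
  add_mem' := by
    intro f g hf hg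
    refine (Set.Finite.union hf hg).subset ?_
    rintro x ⟨v, hv, hx⟩
    by_cases h : f v = 0
    · exact Or.inr ⟨v, hv, fun h' => hx (by simp [h, h'])⟩
    · exact Or.inl ⟨v, hv, h⟩
  smul_mem' := by
    intro c f hf
    refine Set.Finite.subset hf ?_
    rintro x ⟨v, hv, hx⟩
    exact ⟨v, hv, fun h' => hx (by simp [h'])⟩

/-- Assumption (A) on a conformal vertex algebra `(V, ω)` with a Heisenberg subspace `H`.
In `A3`, `A4` the numbers `(α,β)` are complex; on `M_{V,H}` they are real by `A3`.
`A5` contains the Heisenberg relation `h(0)h' = 0`. `A7` says that `V` is isomorphic, as a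
`V`-module, to its restricted dual with the contragredient action. -/
structure AssumptionA {ω : V} (hω : IsConformal ω) (P : HeisenbergSubspace V) : Prop where
  A1 : ∀ h : P.H, (∀ n : ℤ, 1 ≤ n → L ω n (h : V) = 0) ∧ L ω 0 (h : V) = h
  A2 : ∀ h : P.H, Diagonalizable (Y (h : V) 0)
  A3 : ∀ α ∈ P.weights ω, ∀ β ∈ P.weights ω, ∃ x : ℝ, P.form α β = x
  A4 : ∀ α ∈ P.weights ω, ∀ n : ℤ, (n : ℝ) < (P.form α α).re / 2 → P.bigraded ω n α = ⊥
  A5 : P.bigraded ω 0 0 = ℂ ∙ (vac : V) ∧ P.bigraded ω 1 0 = P.H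
  A6 : ∀ (n : ℤ) (α : P.H), FiniteDimensional ℂ (P.bigraded ω n α)
  A7 : ∃ φ : V ≃ₗ[ℂ] P.restrictedDual ω, ∀ (a : V) (n : ℤ) (v : V),
    (φ (Y a n v) : Module.Dual ℂ V) = hω.dualMode a n (φ v)

end HeisenbergSubspace

end VertexAlgebra

end

/-!
The heart of the matter is that `Ω^α` is exactly the space `V^α_{(α,α)/2}` of vectors of charge `α`
and of the least weight that `A4` allows (`Omega_eq_bigraded`). Everything else follows from this
equality, from self-duality and from the absence of zero divisors.

*Vectors of `Ω^α` have weight `(α,α)/2`* (`Omega_le_bigraded`). On `Ω^α` the condition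
`Tv = ω_H(0)v` reads `Tv = α(-1)v`. Applying `L(n)`, `n ≥ 1`, to it, one gets by downward induction
on `n` that `L(n)v = 0` for `n ≥ 1`, and then, from `n = 1`, that `2L(0)v = (α,α)v`.

*Vectors of minimal weight lie in `Ω^α`* (`T_eq_of_minimal_weight`). For nonzero
`v ∈ V_n^α`, `n = (α,α)/2`, the bound `A4` gives `h(i)v = 0` for `i ≥ 1`, and self-duality together
with `A4` provides an inverse `v' ∈ V_n^{-α}`, with `v'(2n-1)v = 𝟏` (`exists_inverse`). Since
`V_1^0 = H`, the next coefficient is forced: `Y(v', z)v = z^(-2n)(𝟏 - αz + ⋯)`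
(`second_coefficient`). Put `x = Tv - α(-1)v`. These two coefficients, and the pole orders of
`Y(v', z)v` and `Y(v, z)v` given by `A4`, show that `v'(m)x = 0` for `m ≥ 2n-1` and `v(m)x = 0` for
`m ≥ -2n`. The Borcherds identity writes `x = (v'(2n-1)v)(-1)x` as a sum of terms of the forms
`v'(m')v(m)x` and `v(m)v'(m')x` with `m`, respectively `m'`, in these ranges, so `x = 0`.

*Goodness* (`isGood`). `Ω^0 = V_0^0 = ℂ𝟏`. For `v ∈ Ω^α` and `w ∈ Ω^β` the equation `Tv = α(-1)v`
determines the leading exponent of `Y(v, z)w`, which is `(α,β)` unless `Y(v, z)w = 0`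
(`omegaMul_ne_zero`). The latter is impossible for nonzero `v`, `w`: the annihilator of `v` is stable
under all modes (`annihilator_mode`), and self-duality with `V_0^0 = ℂ𝟏` shows that a mode of some
vector takes `w` to `𝟏` (`exists_mode_eq_vac`), while `v(-1)𝟏 = v ≠ 0`.

The inverse `v'` above also shows that `Ω^α ≠ 0` implies `Ω^{-α} ≠ 0`, whence the description of
the maximal lattice.
-/

/-! ### Consequences of the Borcherds identity -/

namespace VertexAlgebra

section Modes

variable {V : Type*} [AddCommGroup V] [Module ℂ V] [VertexAlgebra V]

theorem mode_commutator (a b c : V) (p q : ℤ) :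
    Y a p (Y b q c) - Y b q (Y a p c) =
      ∑ᶠ i : ℕ, Ring.choose p i • Y (Y a i b) (p + q - i) c := by
  have h := borcherds a b c p q 0
  simp only [zero_add, add_zero] at h
  rw [h, finsum_eq_single _ 0]
  · simp
  · intro i hi
    rw [Ring.choose_zero_pos ℤ (Nat.pos_of_ne_zero hi)]
    simp

theorem mode_zero_commutator (a b c : V) (q : ℤ) :
    Y a 0 (Y b q c) - Y b q (Y a 0 c) = Y (Y a 0 b) q c := by
  rw [mode_commutator, finsum_eq_single _ 0]
  · simp
  · intro i hi
    rw [Ring.choose_zero_pos ℤ (Nat.pos_of_ne_zero hi)]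
    simp

theorem mode_one_commutator (a b c : V) (q : ℤ) :
    Y a 1 (Y b q c) - Y b q (Y a 1 c) = Y (Y a 0 b) (q + 1) c + Y (Y a 1 b) q c := by
  rw [mode_commutator, finsum_eq_sum_of_support_subset (s := {0, 1})]
  · rw [Finset.sum_pair (by simp)]
    simp [add_comm]
  · intro i hi
    by_contra h
    simp only [Finset.coe_insert, Finset.coe_singleton, Set.mem_insert_iff,
      Set.mem_singleton_iff, not_or] at h
    have : Ring.choose (1 : ℤ) i = 0 := by
      have := Ring.choose_natCast (R := ℤ) 1 i
      rw [Nat.cast_one] at this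
      rw [this, Nat.choose_eq_zero_of_lt (by omega), Nat.cast_zero]
    simp [this] at hi

/-- The commutator formula with `a(-1)` when `a(n)b = 0` for `n ≥ 1`, so that only one term
of the expansion survives. -/
theorem mode_neg_one_commutator (a b c : V) (q : ℤ) (hab : ∀ n : ℤ, 1 ≤ n → Y a n b = 0) :
    Y a (-1) (Y b q c) - Y b q (Y a (-1) c) = Y (Y a 0 b) (q - 1) c := by
  rw [mode_commutator, finsum_eq_single _ 0]
  · simp [add_comm, sub_eq_add_neg]
  · intro i hi
    rw [hab i (by omega)]
    simp

/-- The mode `n` of the normally ordered product `a(-1)b`, applied to a vector on which all but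
the first terms of the two sums vanish. -/
theorem normal_product_mode (a b c : V) (n : ℤ) (hb : ∀ i : ℤ, 1 ≤ i → Y b (n + i) c = 0)
    (ha : ∀ i : ℤ, 1 ≤ i → Y a i c = 0) :
    Y (Y a (-1) b) n c = Y a (-1) (Y b n c) + Y b (n - 1) (Y a 0 c) := by
  have h := borcherds a b c 0 n (-1)
  rw [finsum_eq_single _ 0, finsum_eq_single _ 0] at h
  · simpa [sub_eq_add_neg] using h
  · intro i hi
    rw [hb i (by omega), zero_add (i : ℤ), ha i (by omega)]
    simp
  · intro i hi
    rw [Ring.choose_zero_pos ℤ (Nat.pos_of_ne_zero hi)]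
    simp

/-- The leading term of skew-symmetry: if `Y(a, z)b` has a pole of order at most `N`, the
coefficients of `z^(-N)` in `Y(a, z)b` and `Y(b, z)a` agree up to the sign `(-1)^N`. -/
theorem mode_leading_skew (a b : V) (N : ℤ) (h : ∀ n : ℤ, N ≤ n → Y a n b = 0) :
    Y a (N - 1) b = (-1 : ℂ) ^ N • Y b (N - 1) a := by
  have h' := borcherds a b vac (-1) 0 (N - 1)
  rw [finsum_eq_single _ 0, finsum_eq_single _ 0] at h'
  · have e : (-1 : ℂ) ^ (N - 1) = -(-1 : ℂ) ^ N := by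
      rw [zpow_sub_one₀ (by norm_num)]; norm_num
    simpa [creation_neg_one, creation_nonneg, e] using h'
  · intro i hi
    rw [creation_nonneg b _ (by omega), creation_nonneg a _ (by omega)]
    simp
  · intro i hi
    rw [h _ (by omega)]
    simp

theorem vac_mode_nonneg (b : V) (n : ℤ) (hn : 0 ≤ n) : Y (vac : V) n b = 0 := by
  obtain ⟨N, hN⟩ := truncation (vac : V) b
  -- downward induction: skew-symmetry turns the leading mode into `± b(m)𝟏`
  have key : ∀ k : ℕ, ∀ m : ℤ, 0 ≤ m → N - k ≤ m → Y (vac : V) m b = 0 := by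
    intro k
    induction k with
    | zero => intro m _ hm; exact hN m (by simpa using hm)
    | succ k ih =>
      intro m hm0 hm
      have := mode_leading_skew (vac : V) b (m + 1)
        (fun n hn => ih n (by omega) (by push_cast at hm; omega))
      rw [add_sub_cancel_right, creation_nonneg b m hm0, smul_zero] at this
      exact this
  exact key (N - n).toNat n hn (by omega)

theorem vac_mode_neg_one (b : V) : Y (vac : V) (-1) b = b := by
  simpa [creation_neg_one] using
    mode_leading_skew (vac : V) b 0 (fun n hn => vac_mode_nonneg b n hn)

theorem choose_neg_one_int (i : ℕ) : Ring.choose (-1 : ℤ) i = (-1) ^ i := by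
  induction i with
  | zero => simp
  | succ i ih =>
    have h := Ring.choose_succ_succ (-1 : ℤ) i
    rw [neg_add_cancel, Ring.choose_zero_succ, ih] at h
    rw [pow_succ]
    linarith

theorem vac_mode_of_lt (a : V) (n : ℕ) : Y (vac : V) (-2 - n) a = 0 := by
  induction n using Nat.strong_induction_on with
  | _ n ih =>
  have h := borcherds (vac : V) a vac (-1) 0 (-2 - n)
  -- the nonzero terms on the left are those of `𝟏(-2-n)a` and of `𝟏(-1)a = a`
  rw [finsum_eq_sum_of_support_subset (s := {0, n + 1}), Finset.sum_pair (by simp),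
    finsum_eq_single _ 0] at h
  · have e : (-1 : ℂ) ^ (-2 - (n : ℤ)) = (-1 : ℂ) ^ n := by
      rw [show (-2 - (n : ℤ)) = -((n + 2 : ℕ) : ℤ) by push_cast; ring, zpow_neg, zpow_natCast,
        ← inv_pow, pow_add]
      norm_num
    have e1 : (-2 - (n : ℤ) + ((n + 1 : ℕ) : ℤ)) = -1 := by push_cast; ring
    have e2 : (-1 + 0 - ((n + 1 : ℕ) : ℤ)) = -2 - n := by push_cast; ring
    rw [e1, e2, vac_mode_neg_one, choose_neg_one_int (n + 1), e] at h
    simp only [Nat.cast_zero, add_zero, sub_zero, creation_nonneg a 0 le_rfl, map_zero, zero_sub,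
      creation_neg_one, Ring.choose_zero_right, one_smul, pow_zero, zero_add] at h
    have e3 : ((-1 : ℤ) ^ (n + 1)) • Y a (-2 - n) vac = -((-1 : ℂ) ^ n • Y a (-2 - n) vac) := by
      rw [← Int.cast_smul_eq_zsmul ℂ, ← neg_smul]
      congr 1
      push_cast
      ring
    rw [e3] at h
    simpa using h
  · intro i hi
    rw [creation_nonneg a _ (by omega), creation_nonneg (vac : V) _ (by omega)]
    simp
  · intro i hi
    by_contra hc
    simp only [Finset.coe_insert, Finset.coe_singleton, Set.mem_insert_iff,
      Set.mem_singleton_iff, not_or] at hc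
    apply hi
    by_cases hin : i < n + 1
    · have := ih (n - i) (by omega)
      rw [Nat.cast_sub (by omega), show (-2 - ((n : ℤ) - i)) = -2 - n + i by ring] at this
      simp [this]
    · simp [vac_mode_nonneg a (-2 - n + i) (by omega)]

theorem vac_mode (a : V) (n : ℤ) : Y (vac : V) n a = if n = -1 then a else 0 := by
  split_ifs with h
  · rw [h, vac_mode_neg_one]
  · rcases le_or_gt 0 n with h0 | h0
    · exact vac_mode_nonneg a n h0
    · have := vac_mode_of_lt a (-2 - n).toNat
      rwa [Int.toNat_of_nonneg (by omega), sub_sub_cancel] at this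

/-- `Y(Ta, z) = d/dz Y(a, z)`. -/
theorem T_mode (a c : V) (n : ℤ) : Y (T a) n c = -(n : ℂ) • Y a (n - 1) c := by
  have h := borcherds a vac c n 0 (-2)
  rw [finsum_eq_sum_of_support_subset (s := {0, 1}), Finset.sum_pair (by simp),
    finsum_eq_zero_of_forall_eq_zero] at h
  · simp only [Ring.choose_zero_right, Ring.choose_one_right, Nat.cast_zero, Nat.cast_one,
      add_zero, sub_zero, one_smul, show (-2 + 1 : ℤ) = -1 by norm_num, creation_neg_one] at h
    rw [neg_smul, ← Int.cast_smul_eq_zsmul ℂ] at *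
    exact eq_neg_of_add_eq_zero_left h
  · intro i
    rw [vac_mode, vac_mode, if_neg (by omega), if_neg (by omega)]
    simp
  · intro i hi
    by_contra hc
    simp only [Finset.coe_insert, Finset.coe_singleton, Set.mem_insert_iff,
      Set.mem_singleton_iff, not_or] at hc
    exact hi (by simp [creation_nonneg a (-2 + i) (by omega)])

theorem T_vac : T (vac : V) = 0 := by
  change Y (vac : V) (-2) vac = 0
  rw [vac_mode, if_neg (by norm_num)]

/-- If `Y(v, z)` kills `u`, then it kills `a(m)u`: by locality the annihilator of `v` is a left
ideal. -/
theorem annihilator_mode (v u a : V) (hu : ∀ n, Y v n u = 0) (m n : ℤ) :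
    Y v n (Y a m u) = 0 := by
  obtain ⟨N, hN⟩ := truncation v a
  obtain ⟨M, hM⟩ := truncation a u
  have key : ∀ k : ℕ, ∀ m : ℤ, M - k ≤ m → ∀ n, Y v n (Y a m u) = 0 := by
    intro k
    induction k with
    | zero =>
      intro m hm n
      rw [hM m (by simpa using hm), map_zero]
    | succ k ih =>
      intro m hm n
      have h := borcherds v a u (n - N) m N
      rw [finsum_eq_zero_of_forall_eq_zero, finsum_eq_single _ 0] at h
      · simpa [hu] using h.symm
      · intro i hi
        rw [ih (m + i) (by push_cast at hm; omega), hu]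
        simp
      · intro i
        simp [hN (N + i) (by omega)]
  exact key (M - m).toNat m (by omega) n

end Modes

end VertexAlgebra

/-! ### Simultaneous diagonalization -/

namespace VertexAlgebra

section JointEigenvectors

variable {V : Type*} [AddCommGroup V] [Module ℂ V]

/-- A diagonalizable operator `g` decomposes every eigenvector of an operator `f` commuting with it
into joint eigenvectors; here for a set of such operators at once. -/
theorem mem_span_joint_eigenvectors {ι : Type*} (f : ι → Module.End ℂ V) (g : Module.End ℂ V)
    (hc : ∀ i, Commute (f i) g) (hg : Diagonalizable g) (c : ι → ℂ) (v : V)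
    (hv : ∀ i, f i v = c i • v) :
    v ∈ Submodule.span ℂ {u | (∀ i, f i u = c i • u) ∧ ∃ μ : ℂ, g u = μ • u} := by
  classical
  have hI : DirectSum.IsInternal (fun μ : ℂ => g.eigenspace μ) :=
    DirectSum.isInternal_submodule_of_iSupIndep_of_iSup_eq_top g.eigenspaces_iSupIndep hg
  let _ := hI.chooseDecomposition
  -- the projections to the eigenspaces of `g` commute with the `f i`
  have hproj : ∀ i x μ, (DirectSum.decompose (fun μ : ℂ => g.eigenspace μ) (f i x) μ : V) =
      f i (DirectSum.decompose (fun μ : ℂ => g.eigenspace μ) x μ : V) := by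
    intro i x μ
    have hx : x ∈ ⨆ μ : ℂ, g.eigenspace μ := by rw [hg]; trivial
    induction hx using Submodule.iSup_induction' with
    | mem ν x hx =>
      have hfx : f i x ∈ g.eigenspace ν := Module.End.mapsTo_genEigenspace_of_comm (hc i).symm ν 1 hx
      by_cases h : ν = μ
      · subst h
        rw [DirectSum.decompose_of_mem_same _ hfx, DirectSum.decompose_of_mem_same _ hx]
      · rw [DirectSum.decompose_of_mem_ne _ hfx h, DirectSum.decompose_of_mem_ne _ hx h, map_zero]
    | zero => simp
    | add x y _ _ hx hy => simp [hx, hy]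
  rw [← DirectSum.sum_support_decompose (fun μ : ℂ => g.eigenspace μ) v]
  refine Submodule.sum_mem _ fun μ _ => Submodule.subset_span ⟨fun i => ?_, μ, ?_⟩
  · rw [← hproj, hv, DirectSum.decompose_smul]
    rfl
  · exact Module.End.mem_eigenspace_iff.1
      (DirectSum.decompose (fun μ : ℂ => g.eigenspace μ) v μ).2

/-- Finitely many commuting diagonalizable operators are simultaneously diagonalizable, also in
infinite dimension. -/
theorem span_joint_eigenvectors {ι : Type*} (f : ι → Module.End ℂ V)
    (hc : ∀ i j, Commute (f i) (f j)) (hd : ∀ i, Diagonalizable (f i)) (s : Finset ι) :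
    Submodule.span ℂ {v | ∀ i ∈ s, ∃ μ : ℂ, f i v = μ • v} = ⊤ := by
  classical
  induction s using Finset.induction_on with
  | empty => simp
  | insert j s _ ih =>
    rw [eq_top_iff, ← ih, Submodule.span_le]
    intro v hv
    choose! c hc' using hv
    refine Submodule.span_mono ?_ (mem_span_joint_eigenvectors (fun i : s => f i) (f j)
      (fun i => hc _ _) (hd j) (fun i => c i) v (fun i => hc' i i.2))
    rintro u ⟨h1, h2⟩ i hi
    rcases Finset.mem_insert.1 hi with rfl | hi
    · exact h2
    · exact ⟨_, h1 ⟨i, hi⟩⟩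

end JointEigenvectors

/-! ### Weights and contragredient modes in a conformal vertex algebra -/

section Conformal

variable {V : Type*} [AddCommGroup V] [Module ℂ V] [VertexAlgebra V] {ω : V}

theorem IsConformal.mode_zero (hω : IsConformal ω) (a : V) : Y ω 0 a = T a :=
  congrArg (fun f : Module.End ℂ V => f a) hω.translation

theorem L_zero_apply (a : V) : L ω 0 a = Y ω 1 a := rfl

theorem mem_weightSpace {μ : ℂ} {v : V} : v ∈ weightSpace ω μ ↔ L ω 0 v = μ • v :=
  Module.End.mem_eigenspace_iff

theorem T_mode_commutator (hω : IsConformal ω) (a v : V) (m : ℤ) :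
    T (Y a m v) - Y a m (T v) = -(m : ℂ) • Y a (m - 1) v := by
  rw [← hω.mode_zero, ← hω.mode_zero, mode_zero_commutator, hω.mode_zero, T_mode]

theorem L_zero_mode (hω : IsConformal ω) {μ : ℂ} {a : V} (ha : a ∈ weightSpace ω μ) (v : V)
    (m : ℤ) : L ω 0 (Y a m v) = Y a m (L ω 0 v) + (μ - m - 1) • Y a m v := by
  have h := mode_one_commutator ω a v m
  rw [mem_weightSpace, L_zero_apply] at ha
  rw [hω.mode_zero, T_mode, ha, map_smul, add_sub_cancel_right] at h
  rw [L_zero_apply, L_zero_apply, ← sub_eq_iff_eq_add', h]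
  simp only [Pi.smul_apply, LinearMap.smul_apply, ← add_smul]
  congr 1
  push_cast
  ring

theorem mode_mem_weightSpace (hω : IsConformal ω) {μ ν : ℂ} {a v : V}
    (ha : a ∈ weightSpace ω μ) (hv : v ∈ weightSpace ω ν) (m : ℤ) :
    Y a m v ∈ weightSpace ω (μ + ν - m - 1) := by
  rw [mem_weightSpace, L_zero_mode hω ha, mem_weightSpace.1 hv, map_smul, ← add_smul]
  congr 1
  ring

/-- A primary vector `h` of weight `1` satisfies `[L(n), h(m)] = -m h(n+m)`. -/
theorem L_mode_primary (hω : IsConformal ω) {h : V} (h1 : ∀ n : ℤ, 1 ≤ n → L ω n h = 0)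
    (h0 : L ω 0 h = h) (v : V) (n m : ℤ) :
    L ω n (Y h m v) - Y h m (L ω n v) = -(m : ℂ) • Y h (n + m) v := by
  change Y ω (n + 1) (Y h m v) - Y h m (Y ω (n + 1) v) = _
  rw [mode_commutator, finsum_eq_sum_of_support_subset (s := {0, 1}), Finset.sum_pair (by simp)]
  · have e1 : Y ω 1 h = h := h0
    rw [Nat.cast_zero, Nat.cast_one, hω.mode_zero, e1, T_mode, Ring.choose_zero_right,
      Ring.choose_one_right, ← Int.cast_smul_eq_zsmul ℂ (n + 1), one_smul,
      show n + 1 + m - 0 - 1 = n + m by ring, show n + 1 + m - 1 = n + m by ring, ← add_smul]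
    congr 1
    push_cast
    ring
  · intro i hi
    by_contra hc
    simp only [Finset.coe_insert, Finset.coe_singleton, Set.mem_insert_iff,
      Set.mem_singleton_iff, not_or] at hc
    have := h1 (i - 1) (by omega)
    rw [L, sub_add_cancel] at this
    exact hi (by simp [this])

theorem L_one_mem_weightSpace (hω : IsConformal ω) {μ : ℂ} {v : V} (hv : v ∈ weightSpace ω μ) :
    L ω 1 v ∈ weightSpace ω (μ - 1) := by
  obtain ⟨c, hc⟩ := hω.virasoro
  have h := congrArg (fun f : Module.End ℂ V => f v) (hc 0 1)
  rw [mem_weightSpace] at hv ⊢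
  simp [hv, sub_eq_iff_eq_add] at h
  rw [h, sub_smul, one_smul]
  abel

theorem IsConformal.mem_weightSpace_two (hω : IsConformal ω) : ω ∈ weightSpace ω 2 := by
  obtain ⟨c, hc⟩ := hω.virasoro
  have h := congrArg (fun f : Module.End ℂ V => f vac) (hc 0 (-2))
  simp [L, creation_nonneg, creation_neg_one] at h
  exact mem_weightSpace.2 h

theorem IsConformal.L_one_conformal (hω : IsConformal ω) : L ω 1 ω = 0 := by
  obtain ⟨c, hc⟩ := hω.virasoro
  have h := congrArg (fun f : Module.End ℂ V => f vac) (hc 1 (-2))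
  simp [L, creation_nonneg, creation_neg_one] at h
  exact h

theorem IsConformal.component_of_mem (hω : IsConformal ω) {k : ℤ} {a : V}
    (ha : a ∈ weightSpace ω (k : ℂ)) (l : ℤ) : hω.component l a = if l = k then a else 0 := by
  classical
  have h : (LinearEquiv.ofBijective (DirectSum.coeLinearMap fun n : ℤ => weightSpace ω (n : ℂ))
      hω.isInternal).symm a =
      DirectSum.lof ℂ ℤ (fun n : ℤ => weightSpace ω (n : ℂ)) k ⟨a, ha⟩ := by
    rw [LinearEquiv.symm_apply_eq]
    exact (DirectSum.coeLinearMap_lof (A := fun n : ℤ => weightSpace ω (n : ℂ)) k ⟨a, ha⟩).symm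
  rw [IsConformal.component, h]
  split_ifs with hl
  · subst hl
    rw [DirectSum.lof_apply]
  · rw [DirectSum.lof_eq_of, DirectSum.of_eq_of_ne _ _ _ hl]
    rfl

theorem IsConformal.dualMode_of_mem (hω : IsConformal ω) {k : ℤ} {a : V}
    (ha : a ∈ weightSpace ω (k : ℂ)) (n : ℤ) (f : Module.Dual ℂ V) :
    hω.dualMode a n f = ∑ᶠ j : ℕ, ((-1 : ℂ) ^ k * ((j.factorial : ℂ))⁻¹) •
      (f ∘ₗ Y ((L ω 1 ^ j) a) (2 * k - n - j - 2)) := by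
  rw [IsConformal.dualMode, finsum_eq_single _ k]
  · simp only [hω.component_of_mem ha, if_true]
  · intro l hl
    simp [hω.component_of_mem ha, hl]

/-- For a quasi-primary vector the contragredient mode is a single mode, up to a sign. -/
theorem IsConformal.dualMode_of_quasiprimary (hω : IsConformal ω) {k : ℤ} {a : V}
    (ha : a ∈ weightSpace ω (k : ℂ)) (h1 : L ω 1 a = 0) (n : ℤ) (f : Module.Dual ℂ V) :
    hω.dualMode a n f = (-1 : ℂ) ^ k • (f ∘ₗ Y a (2 * k - n - 2)) := by
  rw [hω.dualMode_of_mem ha, finsum_eq_single _ 0]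
  · simp
  · intro j hj
    obtain ⟨j, rfl⟩ := Nat.exists_eq_succ_of_ne_zero hj
    rw [pow_succ, Module.End.mul_apply, h1]
    simp

end Conformal

end VertexAlgebra

/-! ### Heisenberg subspaces and the grading by weight and charge -/

namespace VertexAlgebra

namespace HeisenbergSubspace

variable {V : Type*} [AddCommGroup V] [Module ℂ V] [VertexAlgebra V] {ω : V}
  {P : HeisenbergSubspace V}

theorem mode_one_eq (h h' : P.H) : Y (h : V) 1 (h' : V) = P.form h h' • (vac : V) :=
  formOf_spec P.H P.mode_one h h'

theorem form_isSymm : P.form.IsSymm where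
  eq h h' := by
    have := mode_leading_skew (h' : V) (h : V) 2 (fun n hn => P.mode_ge_two h' h n hn)
    rw [show (2 - 1 : ℤ) = 1 by norm_num, mode_one_eq, mode_one_eq, smul_smul] at this
    have := smul_left_injective ℂ (vac_ne_zero (V := V)) this
    simpa using this.symm

theorem form_nondegenerate : P.form.Nondegenerate := P.nondegenerate

theorem form_left_injective {α β : P.H} (h : ∀ x : P.H, P.form x α = P.form x β) : α = β := by
  have := form_nondegenerate (P := P)
  rw [← sub_eq_zero]
  refine this.2 _ fun x => ?_
  rw [map_sub, h, sub_self]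

theorem mem_Omega {α : P.H} {v : V} : v ∈ P.Omega α ↔ T v = Y P.sugawara 0 v ∧
    (∀ (h : P.H) (n : ℤ), 1 ≤ n → Y (h : V) n v = 0) ∧
    ∀ h : P.H, Y (h : V) 0 v = P.form h α • v := Iff.rfl

theorem mem_bigraded {μ : ℂ} {α : P.H} {v : V} : v ∈ P.bigraded ω μ α ↔
    v ∈ weightSpace ω μ ∧ ∀ h : P.H, Y (h : V) 0 v = P.form h α • v := by
  simp [bigraded, Submodule.mem_iInf]

/-- On a vacuum-like vector for the Heisenberg algebra, of charge `α`, the operator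
`ω_H(0) = L_H(-1)` acts as `α(-1)`. -/
theorem sugawara_zero_apply {α : P.H} {v : V}
    (h1 : ∀ (h : P.H) (n : ℤ), 1 ≤ n → Y (h : V) n v = 0)
    (h0 : ∀ h : P.H, Y (h : V) 0 v = P.form h α • v) :
    Y P.sugawara 0 v = Y (α : V) (-1) v := by
  have := P.finiteDimensional
  let b := Module.finBasis ℂ P.H
  let d := LinearMap.BilinForm.dualBasis P.form P.nondegenerate b
  have hs : P.sugawara = (1 / 2 : ℂ) • ∑ i, Y (b i : V) (-1) (d i : V) := rfl
  have hmode : ∀ h h' : P.H, Y (Y (h : V) (-1) (h' : V)) 0 v =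
      Y ((P.form h' α • h + P.form h α • h' : P.H) : V) (-1) v := by
    intro h h'
    rw [normal_product_mode _ _ _ _ (fun i hi => h1 h' _ (by omega)) (fun i hi => h1 h i hi),
      h0, h0]
    simp
  have hα1 : ∑ i, P.form (d i) α • b i = α := by
    have := b.sum_repr α
    convert this using 3 with i
    have e := LinearMap.BilinForm.dualBasis_repr_apply (B := P.form) form_nondegenerate d α i
    rw [LinearMap.BilinForm.dualBasis_dualBasis form_nondegenerate form_isSymm b] at e
    rw [e]
    exact form_isSymm.eq _ _
  have hα2 : ∑ i, P.form (b i) α • d i = α := by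
    have := d.sum_repr α
    convert this using 3 with i
    have e := LinearMap.BilinForm.dualBasis_repr_apply (B := P.form) form_nondegenerate b α i
    refine Eq.trans ?_ e.symm
    exact form_isSymm.eq _ _
  have hα : ∑ i, (P.form (d i) α • b i + P.form (b i) α • d i) = (2 : ℂ) • α := by
    rw [Finset.sum_add_distrib, hα1, hα2, two_smul]
  have key : ∑ i, Y (Y (b i : V) (-1) (d i : V)) 0 v = (2 : ℂ) • Y (α : V) (-1) v := by
    simp only [hmode]
    have := congrArg (fun x : P.H => Y (x : V) (-1) v) hα
    simpa [Finset.sum_apply] using this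
  rw [hs]
  simp only [map_smul, map_sum, Pi.smul_apply, Finset.sum_apply, LinearMap.smul_apply,
    LinearMap.sum_apply]
  rw [key, smul_smul]
  norm_num

theorem Omega_T {α : P.H} {v : V} (hv : v ∈ P.Omega α) : T v = Y (α : V) (-1) v := by
  obtain ⟨h, h1, h0⟩ := mem_Omega.1 hv
  rw [h, sugawara_zero_apply h1 h0]

/-- If `Y(v, z)w ≠ 0`, its leading exponent is `(α,β)`, so that the product in `Ω` does not vanish:
`Tv = α(-1)v` gives a first order differential equation for `Y(v, z)w`. -/
theorem omegaMul_ne_zero {α β : P.H} {v w : V} (hv : v ∈ P.Omega α) (hw : w ∈ P.Omega β)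
    (hvw : ∃ n, Y v n w ≠ 0) : P.omegaMul α β v w ≠ 0 := by
  classical
  obtain ⟨N, hN⟩ := truncation v w
  obtain ⟨n, hn, hmax⟩ := Int.exists_greatest_of_bdd (P := fun n => Y v n w ≠ 0)
    ⟨N, fun n hn => by by_contra h; exact hn (hN n (by omega))⟩ hvw
  replace hmax : ∀ m, n < m → Y v m w = 0 := fun m hm => by
    by_contra h
    exact absurd (hmax m h) (by omega)
  have h1 := T_mode v w (n + 1)
  rw [Omega_T hv, normal_product_mode _ _ _ _ (fun i hi => hmax _ (by omega))
    (fun i hi => (mem_Omega.1 hw).2.1 α i hi), hmax _ (by omega), map_zero, zero_add,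
    add_sub_cancel_right, (mem_Omega.1 hw).2.2 α, map_smul] at h1
  have h2 := smul_left_injective ℂ hn h1
  have h3 : ∃ m : ℤ, P.form α β = m := ⟨-(n + 1), by rw [h2]; push_cast; ring⟩
  have h4 : -h3.choose - 1 = n := by
    have := h3.choose_spec
    have : -(n + 1) = h3.choose := by exact_mod_cast h2.symm.trans this
    omega
  rw [omegaMul, dif_pos h3, h4]
  exact hn

theorem Y_mode_mem_bigraded (hω : IsConformal ω) {μ ν : ℂ} {α β : P.H} {a v : V}
    (ha : a ∈ P.bigraded ω μ α) (hv : v ∈ P.bigraded ω ν β) (m : ℤ) :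
    Y a m v ∈ P.bigraded ω (μ + ν - m - 1) (α + β) := by
  rw [mem_bigraded] at *
  refine ⟨mode_mem_weightSpace hω ha.1 hv.1 m, fun h => ?_⟩
  have := mode_zero_commutator (h : V) a v m
  rw [ha.2, hv.2, sub_eq_iff_eq_add] at this
  rw [this, map_add, add_smul]
  simp

namespace AssumptionA

variable {hω : IsConformal ω}

theorem mem_weightSpace_one (hA : AssumptionA hω P) (h : P.H) : (h : V) ∈ weightSpace ω 1 := by
  rw [mem_weightSpace, (hA.A1 h).2, one_smul]

theorem mode_zero_eq_zero (hA : AssumptionA hω P) (h h' : P.H) : Y (h : V) 0 (h' : V) = 0 := by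
  have : (h' : V) ∈ P.bigraded ω 1 0 := by rw [hA.A5.2]; exact h'.2
  simpa using (mem_bigraded.1 this).2 h

theorem bigraded_eq_bot (hA : AssumptionA hω P) (α : P.H) (n : ℤ)
    (hn : (n : ℝ) < (P.form α α).re / 2) : P.bigraded ω n α = ⊥ := by
  by_cases h : α ∈ P.weights ω
  · exact hA.A4 α h n hn
  · by_contra hc
    exact h ⟨n, hc⟩

theorem L_mode (hA : AssumptionA hω P) (h : P.H) (v : V) (n m : ℤ) :
    L ω n (Y (h : V) m v) - Y (h : V) m (L ω n v) = -(m : ℂ) • Y (h : V) (n + m) v :=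
  L_mode_primary hω (hA.A1 h).1 (hA.A1 h).2 v n m

theorem L_one_mem_bigraded (hA : AssumptionA hω P) {μ : ℂ} {α : P.H} {v : V}
    (hv : v ∈ P.bigraded ω μ α) : L ω 1 v ∈ P.bigraded ω (μ - 1) α := by
  rw [mem_bigraded] at *
  refine ⟨L_one_mem_weightSpace hω hv.1, fun h => ?_⟩
  have := hA.L_mode h v 1 0
  rw [hv.2, map_smul] at this
  simpa [sub_eq_zero, eq_comm (a := Y (h : V) 0 _)] using this

theorem L_one_pow_mem_bigraded (hA : AssumptionA hω P) {μ : ℂ} {α : P.H} {v : V}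
    (hv : v ∈ P.bigraded ω μ α) (j : ℕ) : (L ω 1 ^ j) v ∈ P.bigraded ω (μ - j) α := by
  induction j with
  | zero => simpa using hv
  | succ j ih =>
    rw [pow_succ', Module.End.mul_apply]
    convert hA.L_one_mem_bigraded ih using 1
    push_cast
    ring_nf

/-- The operators whose joint eigenspaces are the `V_n^α`: `L(0)` and the `h(0)`. -/
def gradingOperator (ω : V) (P : HeisenbergSubspace V) (o : Option P.H) : Module.End ℂ V :=
  o.elim (L ω 0) fun h => Y (h : V) 0

theorem gradingOperator_commute (hA : AssumptionA hω P) (i j : Option P.H) :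
    Commute (gradingOperator ω P i) (gradingOperator ω P j) := by
  have h0 : ∀ h : P.H, Commute (L ω 0) (Y (h : V) 0) := fun h => LinearMap.ext fun v => by
    simpa [sub_eq_zero] using hA.L_mode h v 0 0
  rcases i with _ | h <;> rcases j with _ | h'
  · exact Commute.refl _
  · exact h0 h'
  · exact (h0 h).symm
  · refine LinearMap.ext fun v => ?_
    have := mode_zero_commutator (h : V) (h' : V) v 0
    rw [hA.mode_zero_eq_zero] at this
    exact sub_eq_zero.1 (this.trans (by simp))

/-- `L(0)` and the `h(0)` are simultaneously diagonalizable. -/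
theorem span_bigraded (hA : AssumptionA hω P) :
    Submodule.span ℂ {v | ∃ (n : ℤ) (α : P.H), v ∈ P.bigraded ω n α} = ⊤ := by
  have := P.finiteDimensional
  let b := Module.finBasis ℂ P.H
  let d := LinearMap.BilinForm.dualBasis P.form P.nondegenerate b
  let f := gradingOperator ω P
  have hc := hA.gradingOperator_commute
  have hd : ∀ i, Diagonalizable (f i) := by
    rintro (_ | h)
    · exact hω.semisimple
    · exact hA.A2 h
  classical
  have key := span_joint_eigenvectors f hc hd (insert none (Finset.univ.image fun i => some (b i)))
  rw [eq_top_iff, ← key, Submodule.span_le]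
  intro v hv
  by_cases hv0 : v = 0
  · rw [hv0]; exact Submodule.zero_mem _
  refine Submodule.subset_span ?_
  obtain ⟨μ, hμ⟩ := hv none (Finset.mem_insert_self _ _)
  obtain ⟨n, rfl⟩ := hω.integral μ
    (Module.End.hasEigenvalue_of_hasEigenvector ⟨Module.End.mem_eigenspace_iff.2 hμ, hv0⟩)
  have hb : ∀ i, ∃ c : ℂ, Y (b i : V) 0 v = c • v := fun i =>
    hv (some (b i)) (Finset.mem_insert_of_mem (Finset.mem_image_of_mem _ (Finset.mem_univ i)))
  choose c hc using hb
  have hγ : ∃ γ : P.H, ∀ i, P.form (b i) γ = c i := by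
    refine ⟨∑ j, c j • d j, fun i => ?_⟩
    rw [map_sum, Finset.sum_eq_single i]
    · have := LinearMap.BilinForm.apply_dualBasis_right form_nondegenerate form_isSymm b i i
      rw [map_smul, smul_eq_mul]
      rw [if_pos rfl] at this
      rw [show d i = P.form.dualBasis form_nondegenerate b i from rfl, this, mul_one]
    · intro j _ hj
      have := LinearMap.BilinForm.apply_dualBasis_right form_nondegenerate form_isSymm b i j
      rw [if_neg (Ne.symm hj)] at this
      rw [map_smul, show d j = P.form.dualBasis form_nondegenerate b j from rfl, this, smul_zero]
    · simp
  obtain ⟨γ, hγ⟩ := hγ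
  refine ⟨n, γ, mem_bigraded.2 ⟨mem_weightSpace.2 hμ, fun h => ?_⟩⟩
  -- both sides are linear in `h`
  have hlin : LinearMap.applyₗ v ∘ₗ LinearMap.proj 0 ∘ₗ Y ∘ₗ P.H.subtype =
      LinearMap.toSpanSingleton ℂ V v ∘ₗ P.form.flip γ :=
    b.ext fun i => by simpa [hγ] using hc i
  simpa using LinearMap.congr_fun hlin h

/-- The eigenspaces `V_n^α` are independent. -/
theorem iSupIndep_bigraded (hA : AssumptionA hω P) :
    iSupIndep fun x : ℂ × P.H => P.bigraded ω x.1 x.2 := by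
  let f := gradingOperator ω P
  have hc := hA.gradingOperator_commute
  let χ : ℂ × P.H → Option P.H → ℂ := fun x o => o.elim x.1 fun h => P.form h x.2
  have hχ : Function.Injective χ := fun x y hxy => by
    refine Prod.ext (congrFun hxy none) (form_left_injective fun h => congrFun hxy (some h))
  refine ((Module.End.independent_iInf_maxGenEigenspace_of_forall_mapsTo f fun i j φ =>
    (f j).mapsTo_maxGenEigenspace_of_comm (hc j i) φ).comp hχ).mono fun x => ?_
  intro v hv
  obtain ⟨h1, h2⟩ := mem_bigraded.1 hv
  simp only [Function.comp_apply, Submodule.mem_iInf]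
  have hle : ∀ (g : Module.End ℂ V) (μ : ℂ), g v = μ • v → v ∈ g.maxGenEigenspace μ :=
    fun g μ hg => (g.genEigenspace μ).monotone le_top (Module.End.mem_eigenspace_iff.2 hg)
  rintro (_ | h)
  · exact hle _ _ (mem_weightSpace.1 h1)
  · exact hle _ _ (h2 h)

end AssumptionA

end HeisenbergSubspace

end VertexAlgebra

/-! ### Self-duality -/

namespace VertexAlgebra

namespace HeisenbergSubspace

variable {V : Type*} [AddCommGroup V] [Module ℂ V] [VertexAlgebra V] {ω : V}
  {P : HeisenbergSubspace V}

namespace AssumptionA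

variable {hω : IsConformal ω}

/-- The restricted dual separates the vectors of the `V_n^β` from `0`. -/
theorem exists_restrictedDual (hA : AssumptionA hω P) {n : ℤ} {β : P.H} {w : V}
    (hw : w ∈ P.bigraded ω n β) (hw0 : w ≠ 0) : ∃ f ∈ P.restrictedDual ω, f w ≠ 0 := by
  have hind := hA.iSupIndep_bigraded ((n : ℂ), β)
  obtain ⟨f, hf, hker⟩ := Submodule.exists_le_ker_of_notMem
    (fun h => hw0 (Submodule.disjoint_def.1 hind w hw h))
  refine ⟨f, (Set.finite_singleton (n, β)).subset ?_, hf⟩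
  rintro ⟨m, γ⟩ ⟨v, hv, hfv⟩
  by_contra hne
  refine hfv (hker ?_)
  refine Submodule.mem_iSup_of_mem ((m : ℂ), γ) (Submodule.mem_iSup_of_mem (fun h => hne ?_) hv)
  simpa using h

/-- For an invariant pairing `φ`, the functional `φ(𝟏)` is supported on `V_0^0`: invariance moves
`L(0)` and `h(0)`, which kill `𝟏`, from `𝟏` to the argument. -/
theorem dual_vac_apply_eq_zero (hA : AssumptionA hω P) {φ : V →ₗ[ℂ] Module.Dual ℂ V}
    (hφ : ∀ (a : V) (n : ℤ) (v : V), φ (Y a n v) = hω.dualMode a n (φ v))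
    {n : ℤ} {γ : P.H} {v : V} (hv : v ∈ P.bigraded ω n γ) (h0 : ¬(n = 0 ∧ γ = 0)) :
    φ vac v = 0 := by
  obtain ⟨hv1, hv2⟩ := mem_bigraded.1 hv
  by_cases hn : n = 0
  · have hγ : γ ≠ 0 := fun h => h0 ⟨hn, h⟩
    obtain ⟨h, hh⟩ : ∃ h : P.H, P.form h γ ≠ 0 := by
      by_contra! hc
      exact hγ (form_left_injective (by simpa using hc))
    have e := hφ h 0 vac
    rw [creation_nonneg _ _ le_rfl, map_zero, hω.dualMode_of_quasiprimary (k := 1)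
      (by simpa using hA.mem_weightSpace_one h) ((hA.A1 h).1 1 le_rfl)] at e
    have e' := LinearMap.congr_fun e v
    simp [hv2] at e'
    exact e'.resolve_left hh
  · have e := hφ ω 1 vac
    rw [creation_nonneg _ _ (by norm_num), map_zero, hω.dualMode_of_quasiprimary (k := 2)
      (by simpa using hω.mem_weightSpace_two) hω.L_one_conformal] at e
    have e' := LinearMap.congr_fun e v
    rw [mem_weightSpace, L_zero_apply] at hv1
    simp [hv1] at e'
    exact e'.resolve_left hn

/-- Self-duality: every nonzero vector of `V_n^β` is sent to the vacuum by a mode of a vector of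
`V_(n-j)^(-β)`, for some `j ≥ 0`. It is a multiple of `L(1)^j u`, where `u` pairs nontrivially
with the given vector `w`, and is found by expanding `⟨u, w⟩ = ⟨u(-1)𝟏, w⟩` by invariance. -/
theorem exists_mode_eq_vac (hA : AssumptionA hω P) {n : ℤ} {β : P.H} {w : V}
    (hw : w ∈ P.bigraded ω n β) (hw0 : w ≠ 0) :
    ∃ (j : ℕ) (b : V), b ∈ P.bigraded ω ((n - j : ℤ) : ℂ) (-β) ∧
      Y b (2 * n - 1 - j) w = vac := by
  obtain ⟨e, he⟩ := hA.A7
  let φ : V →ₗ[ℂ] Module.Dual ℂ V := (P.restrictedDual ω).subtype ∘ₗ e.toLinearMap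
  have hφ : ∀ (a : V) (n : ℤ) (v : V), φ (Y a n v) = hω.dualMode a n (φ v) := he
  obtain ⟨f, hf, hfw⟩ := hA.exists_restrictedDual hw hw0
  -- the pairing with `w` is nonzero on some bihomogeneous `u`
  obtain ⟨k, γ, u, hu, hφu⟩ : ∃ (k : ℤ) (γ : P.H), ∃ u ∈ P.bigraded ω k γ, φ u w ≠ 0 := by
    by_contra! hc
    have hle : (⊤ : Submodule ℂ V) ≤ LinearMap.ker (LinearMap.applyₗ w ∘ₗ φ) := by
      rw [← hA.span_bigraded, Submodule.span_le]
      rintro u ⟨k, γ, hu⟩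
      exact hc k γ u hu
    have : φ (e.symm ⟨f, hf⟩) w = 0 := hle trivial
    exact hfw (by simpa [φ] using this)
  have h1 := hφ u (-1) vac
  rw [creation_neg_one, hω.dualMode_of_mem (mem_bigraded.1 hu).1] at h1
  -- so one of the terms of the contragredient mode is nonzero on `w`
  obtain ⟨j, hj⟩ : ∃ j : ℕ, φ vac (Y ((L ω 1 ^ j) u) (2 * k - 1 - j) w) ≠ 0 := by
    by_contra! hc
    refine hφu ?_
    rw [h1]
    refine finsum_induction (fun g : Module.Dual ℂ V => g w = 0) rfl
      (fun g g' h h' => by rw [LinearMap.add_apply, h, h', add_zero]) fun j => ?_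
    have := hc j
    rw [show 2 * k - 1 - (j : ℤ) = 2 * k - -1 - j - 2 by ring] at this
    rw [LinearMap.smul_apply, LinearMap.comp_apply, this, smul_zero]
  have hb := hA.L_one_pow_mem_bigraded hu j
  have hx : Y ((L ω 1 ^ j) u) (2 * k - 1 - j) w ∈ P.bigraded ω ((n - k : ℤ) : ℂ) (γ + β) := by
    convert Y_mode_mem_bigraded hω hb hw (2 * k - 1 - j) using 2
    push_cast
    ring
  have h0 : n - k = 0 ∧ γ + β = 0 := by
    by_contra hc
    exact hj (hA.dual_vac_apply_eq_zero hφ hx hc)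
  obtain rfl : n = k := by omega
  obtain rfl : γ = -β := eq_neg_of_add_eq_zero_left h0.2
  rw [h0.1, h0.2, Int.cast_zero, hA.A5.1] at hx
  obtain ⟨c, hc⟩ := Submodule.mem_span_singleton.1 hx
  have hc0 : c ≠ 0 := by
    rintro rfl
    rw [← hc, zero_smul, map_zero] at hj
    exact hj rfl
  refine ⟨j, c⁻¹ • (L ω 1 ^ j) u, Submodule.smul_mem _ _ (by push_cast; exact hb), ?_⟩
  rw [map_smul, Pi.smul_apply, LinearMap.smul_apply, ← hc, smul_smul, inv_mul_cancel₀ hc0, one_smul]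

/-- There are no zero divisors, as in a simple vertex algebra. -/
theorem exists_mode_ne_zero (hA : AssumptionA hω P) {n : ℤ} {β : P.H} {v w : V}
    (hw : w ∈ P.bigraded ω n β) (hw0 : w ≠ 0) (hv0 : v ≠ 0) : ∃ m, Y v m w ≠ 0 := by
  by_contra! hc
  obtain ⟨j, b, -, hb⟩ := hA.exists_mode_eq_vac hw hw0
  have := annihilator_mode v w b hc (2 * n - 1 - j) (-1)
  rw [hb, creation_neg_one] at this
  exact hv0 this

/-- `Ω^α` has the weight `(α,α)/2`: with `D = T - α(-1)`, which kills `v`, one has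
`D L(n)v = -(n+1) L(n-1)v` for `n ≥ 2` and `D L(1)v = ((α,α) - 2 L(0))v`, so that the `L(n)v`
vanish, by downward induction on `n`. -/
theorem Omega_le_bigraded (hA : AssumptionA hω P) (α : P.H) :
    P.Omega α ≤ P.bigraded ω (P.form α α / 2) α := by
  intro v hv
  have hT := Omega_T hv
  obtain ⟨-, hh, h0⟩ := mem_Omega.1 hv
  obtain ⟨c, hc⟩ := hω.virasoro
  have hrec : ∀ n : ℤ, 1 ≤ n → T (L ω n v) - Y (α : V) (-1) (L ω n v) =
      Y (α : V) (n - 1) v - ((n : ℂ) + 1) • L ω (n - 1) v := by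
    intro n hn
    have e1 := congrArg (fun f : Module.End ℂ V => f v) (hc n (-1))
    have e2 := hA.L_mode α v n (-1)
    simp only [LinearMap.sub_apply, Module.End.mul_apply, LinearMap.add_apply,
      LinearMap.smul_apply] at e1
    rw [hω.translation, hT] at e1
    have e3 : (if n + -1 = 0 then (((n : ℂ) ^ 3 - n) / 12 * c) • (1 : Module.End ℂ V)
        else 0) = 0 := by
      split_ifs with h
      · obtain rfl : n = 1 := by omega
        simp
      · rfl
    rw [e3, LinearMap.zero_apply, add_zero, sub_eq_iff_eq_add] at e1
    rw [sub_eq_iff_eq_add, e1] at e2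
    simp only [Int.cast_neg, Int.cast_one, neg_neg, one_smul, sub_neg_eq_add, ← sub_eq_add_neg]
      at e2
    rw [sub_eq_iff_eq_add, sub_add_eq_add_sub, eq_sub_iff_add_eq, add_comm, e2]
  obtain ⟨N, hN⟩ := truncation ω v
  have hL : ∀ k : ℕ, ∀ n : ℤ, 1 ≤ n → N - k ≤ n → L ω n v = 0 := by
    intro k
    induction k with
    | zero => intro n _ hn; exact hN (n + 1) (by push_cast at hn; omega)
    | succ k ih =>
      intro n h1 hn
      have e := hrec (n + 1) (by omega)
      rw [ih (n + 1) (by omega) (by push_cast at hn; omega), map_zero, map_zero, sub_zero,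
        add_sub_cancel_right, hh α n h1, zero_sub, eq_comm, neg_eq_zero, smul_eq_zero] at e
      refine e.resolve_left fun h => ?_
      have : n + 1 + 1 = 0 := by exact_mod_cast h
      omega
  have e := hrec 1 le_rfl
  rw [hL (N - 1).toNat 1 le_rfl (by omega), map_zero, map_zero, sub_zero, sub_self, h0] at e
  refine mem_bigraded.2 ⟨mem_weightSpace.2 ?_, h0⟩
  rw [eq_comm, sub_eq_zero] at e
  rw [div_eq_inv_mul, mul_smul, e, smul_smul]
  norm_num

/-- Opposite vectors of minimal weight, with product the vacuum: if `v` is a nonzero vector of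
`V_n^α` with `n = (α,α)/2`, there is `v'` in `V_n^(-α)` with `v'(2n-1)v = 𝟏`. -/
theorem exists_inverse (hA : AssumptionA hω P) {n : ℤ} {α : P.H} (hn : P.form α α / 2 = n) {v : V}
    (hv : v ∈ P.bigraded ω n α) (hv0 : v ≠ 0) :
    ∃ v' ∈ P.bigraded ω n (-α), Y v' (2 * n - 1) v = vac := by
  obtain ⟨j, b, hb, hbv⟩ := hA.exists_mode_eq_vac hv hv0
  have hre : (P.form α α).re / 2 = n := by
    have := congrArg Complex.re hn
    simpa using this
  rcases Nat.eq_zero_or_pos j with rfl | hj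
  · exact ⟨b, by simpa using hb, by simpa using hbv⟩
  · rw [hA.bigraded_eq_bot (-α) (n - j) (by
      have : (0 : ℝ) < j := by exact_mod_cast hj
      simp [hre, hj]), Submodule.mem_bot] at hb
    rw [hb] at hbv
    simp only [map_zero, Pi.zero_apply, LinearMap.zero_apply] at hbv
    exact absurd hbv.symm vac_ne_zero

end AssumptionA

end HeisenbergSubspace

end VertexAlgebra

/-! ### Vectors of minimal weight -/

namespace VertexAlgebra

namespace HeisenbergSubspace

variable {V : Type*} [AddCommGroup V] [Module ℂ V] [VertexAlgebra V] {ω : V}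
  {P : HeisenbergSubspace V}

namespace AssumptionA

variable {hω : IsConformal ω}

/-- The bound `A4` on weights, as a bound on the pole of `Y(a, z)w`. Here `k` is
`(α+β,α+β)/2`. -/
theorem mode_eq_zero_of_lt (hA : AssumptionA hω P) {k l m : ℤ} {α β : P.H} {a w : V}
    (ha : a ∈ P.bigraded ω l α) (hw : w ∈ P.bigraded ω m β)
    (hk : P.form (α + β) (α + β) = 2 * k) (i : ℤ) (hi : l + m - i - 1 < k) : Y a i w = 0 := by
  have h := Y_mode_mem_bigraded hω ha hw i
  rw [show (l : ℂ) + m - i - 1 = ((l + m - i - 1 : ℤ) : ℂ) by push_cast; ring,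
    hA.bigraded_eq_bot _ _ ?_, Submodule.mem_bot] at h
  · exact h
  · have : (P.form (α + β) (α + β)).re = 2 * k := by rw [hk]; simp
    rw [this]
    have : ((l + m - i - 1 : ℤ) : ℝ) < k := by exact_mod_cast hi
    linarith

theorem heisenberg_mode_eq_zero (hA : AssumptionA hω P) {n : ℤ} {α : P.H} {v : V}
    (hv : v ∈ P.bigraded ω n α) (hn : P.form α α = 2 * n) (h : P.H) (i : ℤ) (hi : 1 ≤ i) :
    Y (h : V) i v = 0 := by
  have hh : (h : V) ∈ P.bigraded ω ((1 : ℤ) : ℂ) 0 := by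
    rw [Int.cast_one, hA.A5.2]
    exact h.2
  exact hA.mode_eq_zero_of_lt hh hv (k := n) (by simpa using hn) i (by omega)

/-- In `Y(v', z)v = z^(-2n) (𝟏 - α z + ⋯)` the second coefficient is determined by the first one,
because it lies in `V_1^0 = H`. -/
theorem second_coefficient (hA : AssumptionA hω P) {n : ℤ} {α : P.H} (hn : P.form α α = 2 * n)
    {v v' : V} (hv : v ∈ P.bigraded ω n α) (hv' : v' ∈ P.bigraded ω n (-α))
    (hvv : Y v' (2 * n - 1) v = vac) : Y v' (2 * n - 2) v = -(α : V) := by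
  have hmem : Y v' (2 * n - 2) v ∈ P.H := by
    rw [← hA.A5.2]
    convert Y_mode_mem_bigraded hω hv' hv (2 * n - 2) using 1
    · push_cast
      ring_nf
      rw [neg_add_cancel]
  have hn' : P.form (-α) (-α) = 2 * n := by simpa using hn
  have key : (⟨_, hmem⟩ : P.H) = -α := by
    refine form_left_injective fun h => ?_
    have e := mode_one_commutator (h : V) v' v (2 * n - 2)
    rw [hA.heisenberg_mode_eq_zero hv hn h 1 le_rfl,
      hA.heisenberg_mode_eq_zero hv' hn' h 1 le_rfl, (mem_bigraded.1 hv').2,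
      show 2 * n - 2 + 1 = 2 * n - 1 by ring, map_smul, Pi.smul_apply, LinearMap.smul_apply, hvv,
      map_zero, map_zero, sub_zero, Pi.zero_apply, LinearMap.zero_apply, add_zero] at e
    have e1 := mode_one_eq h (⟨_, hmem⟩ : P.H)
    exact smul_left_injective ℂ (vac_ne_zero (V := V)) (e1.symm.trans e)
  exact congrArg Subtype.val key

/-- The modes of `a ∈ V^γ` on `x = Tv - α(-1)v`. -/
theorem mode_T_sub (hω : IsConformal ω) {α γ : P.H} {a v : V}
    (h0 : Y (α : V) 0 a = P.form α γ • a) (h1 : ∀ i : ℤ, 1 ≤ i → Y (α : V) i a = 0) (m : ℤ) :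
    Y a m (T v - Y (α : V) (-1) v) = T (Y a m v) - Y (α : V) (-1) (Y a m v) +
      (m + P.form α γ) • Y a (m - 1) v := by
  have e1 := T_mode_commutator hω a v m
  have e2 := mode_neg_one_commutator (α : V) a v m h1
  rw [h0, map_smul, Pi.smul_apply, LinearMap.smul_apply] at e2
  rw [map_sub, add_smul]
  rw [neg_smul] at e1
  rw [← e2, ← neg_eq_iff_eq_neg.2 e1]
  abel

/-- A vector `v` of `V^α` of the minimal weight `n = (α,α)/2` satisfies `Tv = α(-1)v`. With `v'` as
in `exists_inverse`, the defect `x = Tv - α(-1)v` satisfies `v'(m)x = 0` for `m ≥ 2n-1` and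
`v(m)x = 0` for `m ≥ -2n`, and associativity expresses `x = (v'(2n-1)v)(-1)x` through these. -/
theorem T_eq_of_minimal_weight (hA : AssumptionA hω P) {n : ℤ} {α : P.H}
    (hn : P.form α α = 2 * n) {v : V} (hv : v ∈ P.bigraded ω n α) :
    T v = Y (α : V) (-1) v := by
  by_cases hv0 : v = 0
  · simp [hv0]
  obtain ⟨v', hv', hvv⟩ := hA.exists_inverse (n := n) (by rw [hn]; ring) hv hv0
  have hn' : P.form (-α) (-α) = 2 * n := by simpa using hn
  have hvv0 : ∀ m : ℤ, 2 * n ≤ m → Y v' m v = 0 := fun m hm =>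
    hA.mode_eq_zero_of_lt hv' hv (k := 0) (by simp) m (by omega)
  have hv20 : ∀ m : ℤ, -(2 * n) ≤ m → Y v m v = 0 := fun m hm =>
    hA.mode_eq_zero_of_lt hv hv (k := 4 * n) (by simp [hn]; ring) m (by omega)
  have hv'x : ∀ m : ℤ, 2 * n - 1 ≤ m → Y v' m (T v - Y (α : V) (-1) v) = 0 := by
    intro m hm
    rw [mode_T_sub hω ((mem_bigraded.1 hv').2 α)
      (fun i hi => hA.heisenberg_mode_eq_zero hv' hn' α i hi)]
    rcases hm.eq_or_lt with rfl | hm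
    · rw [hvv, T_vac, creation_neg_one, show 2 * n - 1 - 1 = 2 * n - 2 by ring,
        hA.second_coefficient hn hv hv' hvv, map_neg, hn]
      push_cast
      module
    rw [hvv0 m (by omega), map_zero, map_zero, sub_zero, zero_add, map_neg, hn]
    rcases (show 2 * n ≤ m by omega).eq_or_lt with rfl | hm
    · push_cast
      module
    · rw [hvv0 (m - 1) (by omega), smul_zero]
  have hvx : ∀ m : ℤ, -(2 * n) ≤ m → Y v m (T v - Y (α : V) (-1) v) = 0 := by
    intro m hm
    rw [mode_T_sub hω ((mem_bigraded.1 hv).2 α)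
      (fun i hi => hA.heisenberg_mode_eq_zero hv hn α i hi), hv20 m hm, map_zero, map_zero,
      sub_zero, zero_add, hn]
    rcases hm.eq_or_lt with rfl | hm
    · push_cast
      module
    · rw [hv20 (m - 1) (by omega), smul_zero]
  rw [← sub_eq_zero]
  generalize T v - Y (α : V) (-1) v = x at hv'x hvx
  have h := borcherds v' v x (2 * n - 1) (-(2 * n)) (2 * n - 1)
  rw [finsum_eq_single _ 0, finsum_eq_zero_of_forall_eq_zero] at h
  · have e : 2 * n - 1 + -(2 * n) = -1 := by ring
    simpa [hvv, e, vac_mode_neg_one] using h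
  · intro i
    rw [hvx _ (by omega), hv'x _ (by omega)]
    simp
  · intro i hi
    rw [hvv0 _ (by omega)]
    simp

/-- `Ω^α` is the space of vectors in `V^α` of the minimal weight that `A4` allows. -/
theorem Omega_eq_bigraded (hA : AssumptionA hω P) (α : P.H) :
    P.Omega α = P.bigraded ω (P.form α α / 2) α := by
  refine le_antisymm (hA.Omega_le_bigraded α) fun v hv => ?_
  by_cases hv0 : v = 0
  · rw [hv0]; exact Submodule.zero_mem _
  have hv' := mem_bigraded.1 hv
  obtain ⟨n, hn⟩ := hω.integral _
    (Module.End.hasEigenvalue_of_hasEigenvector ⟨hv'.1, hv0⟩)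
  have hn2 : P.form α α = 2 * n := by rw [← hn]; ring
  rw [hn] at hv
  have h1 := hA.heisenberg_mode_eq_zero hv hn2
  refine mem_Omega.2 ⟨?_, h1, hv'.2⟩
  rw [sugawara_zero_apply h1 hv'.2, hA.T_eq_of_minimal_weight hn2 hv]

theorem Omega_neg_ne_bot (hA : AssumptionA hω P) {α : P.H} (h : P.Omega α ≠ ⊥) :
    P.Omega (-α) ≠ ⊥ := by
  obtain ⟨v, hv, hv0⟩ := Submodule.exists_mem_ne_zero_of_ne_bot h
  rw [hA.Omega_eq_bigraded] at hv
  obtain ⟨n, hn⟩ := hω.integral _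
    (Module.End.hasEigenvalue_of_hasEigenvector ⟨(mem_bigraded.1 hv).1, hv0⟩)
  rw [hn] at hv
  obtain ⟨v', hv', hvv⟩ := hA.exists_inverse hn hv hv0
  rw [hA.Omega_eq_bigraded, Submodule.ne_bot_iff]
  refine ⟨v', by simpa [hn] using hv', ?_⟩
  rintro rfl
  simp only [map_zero, Pi.zero_apply, LinearMap.zero_apply] at hvv
  exact vac_ne_zero hvv.symm

theorem maximalLattice_eq (hA : AssumptionA hω P) :
    P.maximalLattice = {α : P.H | P.bigraded ω (P.form α α / 2) α ≠ ⊥} := by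
  ext α
  rw [Set.mem_ofPred_eq, ← hA.Omega_eq_bigraded]
  exact ⟨fun h => h.1, fun h => ⟨h, hA.Omega_neg_ne_bot h⟩⟩

theorem isGood (hA : AssumptionA hω P) : P.IsGood := by
  refine ⟨?_, fun α β v hv w hw hv0 hw0 => omegaMul_ne_zero hv hw ?_⟩
  · rw [hA.Omega_eq_bigraded, ← hA.A5.1]
    simp
  · rw [hA.Omega_eq_bigraded] at hw
    obtain ⟨n, hn⟩ := hω.integral _
      (Module.End.hasEigenvalue_of_hasEigenvector ⟨(mem_bigraded.1 hw).1, hw0⟩)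
    rw [hn] at hw
    exact hA.exists_mode_ne_zero hw hw0 hv0

end AssumptionA

end HeisenbergSubspace

end VertexAlgebra

open VertexAlgebra in
theorem mainTheorem5 {V : Type*} [AddCommGroup V] [Module ℂ V] [VertexAlgebra V]
    (ω : V) (hω : IsConformal ω) (P : HeisenbergSubspace V)
    (hA : HeisenbergSubspace.AssumptionA hω P) :
    P.IsGood ∧
    iSupIndep (fun α : {α : P.H | P.bigraded ω (P.form α α / 2) α ≠ ⊥} =>
      P.bigraded ω (P.form α α / 2) α) ∧
    P.latticePart = ⨆ α : {α : P.H | P.bigraded ω (P.form α α / 2) α ≠ ⊥},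
      P.bigraded ω (P.form α α / 2) α ∧
    P.maximalLattice = {α : P.H | P.bigraded ω (P.form α α / 2) α ≠ ⊥} := by
  refine ⟨hA.isGood, ?_, ?_, hA.maximalLattice_eq⟩
  · exact hA.iSupIndep_bigraded.comp
      (f := fun α : {α : P.H | P.bigraded ω (P.form α α / 2) α ≠ ⊥} =>
        (P.form (α : P.H) α / 2, (α : P.H)))
      (fun α β h => Subtype.ext (congrArg Prod.snd h))
  · rw [HeisenbergSubspace.latticePart, hA.maximalLattice_eq]
    exact iSup_congr fun α => hA.Omega_eq_bigraded α
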